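/- **Theorem (nonparametric processes).** Let $n,m,L\ge 0$ be integers and let $\mathcal U$ be a set of regimes (values of an observed categorical variable $\mathbf u$). A *nonparametric process* consists of a mixing function $g:\mathbb R^n\to\mathbb R^m$; parent sets $\mathrm{Pa}(i)\subseteq\{1,\dots,L\}\times\{1,\dots,n\}$; transition functions $f_i$ that are three times differentiable in (parents, noise) and do not depend on the regime; noise distributions $p_{\epsilon_i|\mathbf u}$; and, in each regime $\mathbf u\in\mathcal U$, a latent process $$\mathbf x_t=g(\mathbf z_t)\ \ (t\ge 0),\qquad z_{it}=f_i\big(\{z_{j,t-\tau}:(\tau,j)\in \mathrm{Pa}(i)\},\epsilon_{it}\big),\quad \epsilon_{it}\sim p_{\epsilon_i|\mathbf u}\ \ (t\ge L),$$ started from arbitrary random initial values $\mathbf z_0,\dots,\mathbf z_{L-1}$, such that: * $g$ is injective and differentiable almost everywhere, and it is a homeomorphism onto its range; * in each regime the noise terms $\epsilon_{it}$ are mutually independent (over $i$ and $t$) and independent of the initial values; * for every regime $\mathbf u$, component $i$ and history $H=(\mathbf z_{t-1},\dots,\mathbf z_{t-L})\in(\mathbb R^n)^L$, the conditional distribution of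 $z_{it}$ given $H$ and $\mathbf u$, that is, the law of $f_i(\mathrm{Pa},\epsilon_{it})$ with the parents fixed by $H$, has an everywhere positive density on $\mathbb R$ whose logarithm $q_i(\cdot\,|\,H,\mathbf u)$ is twice differentiable. Put $$\mathbf w(\mathbf z,\mathbf u;H)=\big(q_1'(z_1|H,\mathbf u),\dots,q_n'(z_n|H,\mathbf u),\,q_1''(z_1|H,\mathbf u),\dots,q_n''(z_n|H,\mathbf u)\big)\in\mathbb R^{2n}.$$ The process has *sufficient variability* if for every $\mathbf z\in\mathbb R^n$ there are a history $H$ and $2n+1$ regimes $\mathbf u_0,\dots,\mathbf u_{2n}$ such that the $2n$ vectors $\mathbf w(\mathbf z,\mathbf u_{j+1};H)-\mathbf w(\mathbf z,\mathbf u_j;H)$, $j=0,\dots,2n-1$, are linearly independent. Let $(g,f_i,p_{\epsilon_i|\mathbf u})$ be a nonparametric process with sufficient variability, and let $(\hat g,\hat f_i,\hat p_{\epsilon_i|\mathbf u})$ be another nonparametric process with the same $n,m,L,\mathcal U$ (not assumed to have sufficient variability) such that $\hat g$ and $g$ have the same range, and such that the two are observationally equivalent: in every regime the observed sequences $(\mathbf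 x_t)_{t\ge 0}$ of the two processes have the same joint distribution. Then the latent variables agree up to a permutation and componentwise invertible transformations: there are a permutation $\pi$ of $\{1,\dots,n\}$ and homeomorphisms $T_1,\dots,T_n:\mathbb R\to\mathbb R$ with $$\hat g(z_1,\dots,z_n)=g\big(T_1(z_{\pi(1)}),\dots,T_n(z_{\pi(n)})\big)\qquad\text{for all }\mathbf z\in\mathbb R^n,$$ that is, $\hat g=g\circ T\circ\pi$. -/

import Mathlib

open MeasureTheory ProbabilityTheory

/-- Three times differentiable, in the sense of Fréchet. -/
def ThreeTimesDifferentiable {E : Type*} [NormedAddCommGroup E] [NormedSpace ℝ E]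
    (φ : E → ℝ) : Prop :=
  Differentiable ℝ φ ∧ Differentiable ℝ (fderiv ℝ φ) ∧
    Differentiable ℝ (fderiv ℝ (fderiv ℝ φ))

/-- Values of the latent vector at the last `L` time points: `H τ j` is the value of the `j`-th
latent component at lag `τ + 1`, for `τ = 0, …, L - 1`. -/
abbrev LatentHistory (n L : ℕ) : Type := Fin L → Fin n → ℝ

/-- A nonparametric, nonstationary temporally causal latent process with its mixing function.
There are `n` latent components, `m` observed ones, the maximum time lag is `L`, and `U` is the set
of regimes. The regime is the index of a domain (segment, trial): `P u` is the law that governs the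
whole trajectory in regime `u`. -/
structure NonparametricProcess (n m L : ℕ) (U Ω : Type*) [MeasurableSpace Ω] where
  /-- The time-delayed parents of a component; `(τ, j)` stands for component `j` at lag `τ + 1`. -/
  Pa : Fin n → Finset (Fin L × Fin n)
  /-- The transition functions, of the parents and of the noise; the same in all regimes. -/
  f : (i : Fin n) → ((Pa i → ℝ) × ℝ) → ℝ
  /-- The mixing function. -/
  g : (Fin n → ℝ) → (Fin m → ℝ)
  /-- The noise distributions, one for each regime and component. -/
  noise : U → Fin n → Measure ℝ
  /-- The probability measure in each regime. -/
  P : U → Measure Ω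
  /-- The latent process; the times `0, …, L - 1` hold its initial values. -/
  z : ℕ → Ω → Fin n → ℝ
  /-- The noise; `ε t` enters at time `t + L`, the times before `L` need none. -/
  ε : ℕ → Ω → Fin n → ℝ
  /-- `q u i H` is the log-density of component `i` given the history `H`, in regime `u`. -/
  q : U → Fin n → LatentHistory n L → ℝ → ℝ
  f_diff : ∀ i, ThreeTimesDifferentiable (f i)
  /-- `g` is injective, continuous, and its inverse on its range is continuous. -/
  g_embedding : Topology.IsEmbedding g
  g_ae_diff : ∀ᵐ y : Fin n → ℝ, DifferentiableAt ℝ g y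
  isProb : ∀ u, IsProbabilityMeasure (P u)
  measurable_z : ∀ t, Measurable (z t)
  measurable_ε : ∀ t, Measurable (ε t)
  /-- The transition `z_{i,t} = f_i (Pa (z_{i,t}), ε_{i,t})`. -/
  transition : ∀ u, ∀ᵐ ω ∂(P u), ∀ t i,
    z (t + L) ω i = f i (fun p => z (t + L - (p.1.1 + 1)) ω p.1.2, ε t ω i)
  /-- In regime `u` the noise of component `i` has the law `noise u i`. -/
  noise_law : ∀ u t i, (P u).map (fun ω => ε t ω i) = noise u i
  /-- In each regime the noise terms are mutually independent, over components and times. -/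
  noise_indep : ∀ u, iIndepFun (fun (p : ℕ × Fin n) ω => ε p.1 ω p.2) (P u)
  /-- In each regime the noise is independent of the initial values of the process. -/
  init_indep : ∀ u,
    IndepFun (fun ω (s : Fin L) => z s ω) (fun ω (p : ℕ × Fin n) => ε p.1 ω p.2) (P u)
  /-- The law of `f_i (Pa (z_{i,t}), ε_{i,t})` with the history held fixed at `H`, which is the
  conditional law of `z_{i,t}` given the history and the regime, has the density `exp (q u i H)`. -/
  density : ∀ u i H,
    (noise u i).map (fun e => f i (fun p => H p.1.1 p.1.2, e)) =
      volume.withDensity (fun x => ENNReal.ofReal (Real.exp (q u i H x)))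
  q_diff : ∀ u i H, Differentiable ℝ (q u i H)
  q_diff_two : ∀ u i H, Differentiable ℝ (deriv (q u i H))

namespace NonparametricProcess

variable {n m L : ℕ} {U Ω Ω' : Type*} [MeasurableSpace Ω] [MeasurableSpace Ω']

/-- The observed process `x_t = g (z_t)`. -/
def x (M : NonparametricProcess n m L U Ω) (t : ℕ) (ω : Ω) : Fin m → ℝ := M.g (M.z t ω)

/-- The vector of the first and the second derivatives of the conditional log-densities, each in
its own component. -/
noncomputable def w (M : NonparametricProcess n m L U Ω) (H : LatentHistory n L)
    (y : Fin n → ℝ) (u : U) : Fin n ⊕ Fin n → ℝ :=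
  Sum.elim (fun i => deriv (M.q u i H) (y i)) (fun i => deriv (deriv (M.q u i H)) (y i))

/-- Sufficient variability. The history is the same in the `2 n + 1` regimes; it is enough that
the condition holds for one history, which may depend on `y`. -/
def SufficientVariability (M : NonparametricProcess n m L U Ω) : Prop :=
  ∀ y : Fin n → ℝ, ∃ (H : LatentHistory n L) (u : Fin (2 * n + 1) → U),
    LinearIndependent ℝ
      (fun j : Fin (2 * n) => M.w H y (u j.succ) - M.w H y (u j.castSucc))

/-- Observational equivalence: in each (observed) regime the observed sequences have the same
joint distribution. -/
def ObservationallyEquivalent (M : NonparametricProcess n m L U Ω)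
    (M' : NonparametricProcess n m L U Ω') : Prop :=
  ∀ u, (M.P u).map (fun ω t => M.x t ω) = (M'.P u).map (fun ω t => M'.x t ω)

end NonparametricProcess

/-!
# Identifiability of the latent components

Since `g` and `ĝ` are embeddings with the same range, `ĝ = g ∘ h` for a homeomorphism `h` of `ℝⁿ`,
and the claim is that `h` is a permutation of the coordinates followed by homeomorphisms of the
components. Nothing is known in advance about the differentiability of `h`.

*From observations to conditional laws.* The history `H` before time `t + L` is independent of the
noise at that time, so the pair (history, next value) has the law `law(H) ⊗ₘ κ`, where `κ H` is the
product of the conditional densities `exp (q i H)` (`map_hist_prodMk`). Observational equivalence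
gives the law of the latent trajectory up to `h`, so by uniqueness of disintegrations
`h_* κ̂(Ĥ) = κ(h Ĥ)` for almost every history. As all densities are positive, after `L` transitions
the law of the history has full support (`isOpenPosMeasure_map_hist`), and the kernels are weakly
continuous in the history because the transition functions are continuous; so the identity holds
for every history (`map_pi_expDensity_eq`).

*No Jacobian.* The identity, for a fixed history and two regimes, yields by division of densities
`∑ᵢ dᵢ(hᵢ(y)) = ∑ᵢ d̂ᵢ(yᵢ)` for all `y`, where `d` and `d̂` are the differences of the log-densities
in the two regimes (`sum_sub_eq_of_map_pi_expDensity`). The usual change of variables would involve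
`log |det Dh|`; here it never appears.

*Regularity and second derivatives.* By sufficient variability at `z₀ = h y₀`, linear combinations
of the `2n` differences give separable functions `∑ᵢ e a i (zᵢ)`, indexed by `a`, with prescribed
derivatives at `z₀`: for `n` of them the gradients form the identity matrix and the second
derivatives vanish, for the other `n` the roles are exchanged (`TransportsSeparableAt`). The first
`n` form a local diffeomorphism, so `h` is differentiable. Differentiating the transported
identities in `y l` and then in a direction `w` with `w l = 0`, the first half gives
`∂_w ∂_l hᵢ = 0` and the second half `∂_w hᵢ ∂_l hᵢ = 0`
(`TransportsSeparableAt.second_order`). Thus `∂_l hᵢ` depends on `y l` only, and if it is nonzero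
somewhere then all other partial derivatives of `hᵢ` vanish identically: `hᵢ` is a function of one
coordinate (`exists_coordinate_of_transportsSeparableAt`). Bijectivity of `h` makes the assignment
of coordinates a permutation and the one-variable functions homeomorphisms.
-/

/-! ### Homeomorphisms that preserve additively separable functions -/

/-- Composition with `h` turns certain additively separable functions `∑ i, e a i (z i)`, indexed by
`a : ι ⊕ ι`, into additively separable functions of `y`, where the first and second derivatives of
the `e a i` at `h y₀` form the identity matrix of size `2 * card ι`. The identities hold for all
`y`; only the normalization of the derivatives refers to the point. -/
def TransportsSeparableAt {ι : Type*} [Fintype ι] [DecidableEq ι]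
    (h : (ι → ℝ) → (ι → ℝ)) (y₀ : ι → ℝ) : Prop :=
  ∃ e e' : ι ⊕ ι → ι → ℝ → ℝ,
    (∀ a i, Differentiable ℝ (e a i)) ∧ (∀ a i, Differentiable ℝ (deriv (e a i))) ∧
    (∀ a i, Differentiable ℝ (e' a i)) ∧
    (∀ a y, ∑ i, e a i (h y i) = ∑ i, e' a i (y i)) ∧
    (∀ a i, deriv (e a i) (h y₀ i) = if a = Sum.inl i then 1 else 0) ∧
    (∀ a i, deriv (deriv (e a i)) (h y₀ i) = if a = Sum.inr i then 1 else 0)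

section Separable

variable {ι : Type*} [Fintype ι]

/-- A basis of row vectors can be combined into the unit vectors. -/
lemma exists_sum_mul_eq_ite {κ β : Type*} [Fintype κ] [Fintype β] [DecidableEq β]
    {v : κ → β → ℝ} (hv : LinearIndependent ℝ v) (hcard : Fintype.card κ = Fintype.card β) :
    ∃ c : β → κ → ℝ, ∀ a b, ∑ k, c a k * v k b = if a = b then 1 else 0 := by
  have htop : Submodule.span ℝ (Set.range v) = ⊤ := by
    rcases isEmpty_or_nonempty κ with hκ | hκ
    · have : IsEmpty β := Fintype.card_eq_zero_iff.1 (by rw [← hcard]; simp)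
      exact Subsingleton.elim _ _
    · exact hv.span_eq_top_of_card_eq_finrank (by simp [hcard])
  have h : ∀ a : β, ∃ c : κ → ℝ, ∑ k, c k • v k = Pi.single a 1 := fun a =>
    (Submodule.mem_span_range_iff_exists_fun ℝ).1 (by rw [htop]; trivial)
  choose c hc using h
  refine ⟨c, fun a b => ?_⟩
  have := congrFun (hc a) b
  simpa [Finset.sum_apply, Pi.single_apply, eq_comm] using this

/-- Linear combinations of the transported separable functions normalize their derivatives. -/
lemma transportsSeparableAt_of_linearIndependent [DecidableEq ι] {κ : Type*} [Fintype κ]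
    {h : (ι → ℝ) → (ι → ℝ)} {y₀ : ι → ℝ} (d d' : κ → ι → ℝ → ℝ)
    (hd : ∀ k i, Differentiable ℝ (d k i)) (hd2 : ∀ k i, Differentiable ℝ (deriv (d k i)))
    (hd' : ∀ k i, Differentiable ℝ (d' k i))
    (heq : ∀ k y, ∑ i, d k i (h y i) = ∑ i, d' k i (y i))
    (hli : LinearIndependent ℝ (fun k => (Sum.elim (fun i => deriv (d k i) (h y₀ i))
      (fun i => deriv (deriv (d k i)) (h y₀ i)) : ι ⊕ ι → ℝ)))
    (hcard : Fintype.card κ = Fintype.card (ι ⊕ ι)) : TransportsSeparableAt h y₀ := by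
  obtain ⟨c, hc⟩ := exists_sum_mul_eq_ite hli hcard
  have hderiv : ∀ a i, deriv (fun s => ∑ k, c a k * d k i s)
      = fun s => ∑ k, c a k * deriv (d k i) s := by
    intro a i
    funext s
    exact (HasDerivAt.fun_sum fun k _ => ((hd k i s).hasDerivAt.const_mul (c a k))).deriv
  refine ⟨fun a i s => ∑ k, c a k * d k i s, fun a i s => ∑ k, c a k * d' k i s,
    fun a i => ?_, fun a i => ?_, fun a i => ?_, fun a y => ?_, fun a i => ?_, fun a i => ?_⟩
  · exact Differentiable.fun_sum fun k _ => (hd k i).const_mul _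
  · rw [hderiv]
    exact Differentiable.fun_sum fun k _ => (hd2 k i).const_mul _
  · exact Differentiable.fun_sum fun k _ => (hd' k i).const_mul _
  · calc ∑ i, ∑ k, c a k * d k i (h y i) = ∑ k, c a k * ∑ i, d k i (h y i) := by
          rw [Finset.sum_comm]
          simp only [Finset.mul_sum]
      _ = ∑ i, ∑ k, c a k * d' k i (y i) := by
          simp only [heq, Finset.mul_sum]
          rw [Finset.sum_comm]
  · rw [hderiv]
    exact hc a (Sum.inl i)
  · rw [hderiv, (HasDerivAt.fun_sum fun k _ =>
      ((hd2 k i (h y₀ i)).hasDerivAt.const_mul (c a k))).deriv]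
    exact hc a (Sum.inr i)

/-- By the inverse function theorem for the map `z ↦ (∑ i, e a i (z i))ₐ`, a continuous map that
transports separable functions is automatically differentiable. -/
lemma TransportsSeparableAt.differentiableAt [DecidableEq ι] {h : (ι → ℝ) → (ι → ℝ)}
    {y₀ : ι → ℝ} (H : TransportsSeparableAt h y₀) (hc : ContinuousAt h y₀) :
    DifferentiableAt ℝ h y₀ := by
  obtain ⟨e, e', he, he2, he', heq, h1, -⟩ := H
  let Φ : (ι → ℝ) → (ι → ℝ) := fun z a => ∑ i, e (Sum.inl a) i (z i)
  let Ψ : (ι → ℝ) → (ι → ℝ) := fun z a => ∑ i, e' (Sum.inl a) i (z i)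
  have hΦ : HasStrictFDerivAt Φ ((ContinuousLinearEquiv.refl ℝ (ι → ℝ) : (ι → ℝ) →L[ℝ] (ι → ℝ)))
      (h y₀) := by
    rw [hasStrictFDerivAt_pi']
    intro a
    have key : HasStrictFDerivAt (fun z : ι → ℝ => ∑ i, e (Sum.inl a) i (z i))
        (∑ i, deriv (e (Sum.inl a) i) (h y₀ i) •
          (ContinuousLinearMap.proj i : (ι → ℝ) →L[ℝ] ℝ)) (h y₀) := by
      refine HasStrictFDerivAt.fun_sum fun i _ => ?_
      have hs : HasStrictDerivAt (e (Sum.inl a) i) (deriv (e (Sum.inl a) i) (h y₀ i)) (h y₀ i) :=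
        hasStrictDerivAt_of_hasDerivAt_of_continuousAt
          (Filter.Eventually.of_forall fun s => (he _ i s).hasDerivAt)
          (he2 _ i).continuous.continuousAt
      exact hs.comp_hasStrictFDerivAt (h y₀)
        (ContinuousLinearMap.proj i : (ι → ℝ) →L[ℝ] ℝ).hasStrictFDerivAt
    refine key.congr_fderiv ?_
    ext v
    simp [h1]
  have hΨ : Differentiable ℝ Ψ := by
    rw [differentiable_pi]
    intro a
    exact Differentiable.fun_sum fun i _ => (he' _ i).comp (differentiable_apply i)
  have hinv : h =ᶠ[nhds y₀] fun y => hΦ.localInverse Φ _ (h y₀) (Ψ y) := by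
    filter_upwards [hc.eventually hΦ.eventually_left_inverse] with y hy
    have : Φ (h y) = Ψ y := funext fun a => heq (Sum.inl a) y
    rw [← this, hy]
  have hval : Φ (h y₀) = Ψ y₀ := funext fun a => heq (Sum.inl a) y₀
  refine DifferentiableAt.congr_of_eventuallyEq ?_ hinv
  refine DifferentiableAt.comp y₀ ?_ (hΨ y₀)
  rw [← hval]
  exact hΦ.to_localInverse.hasFDerivAt.differentiableAt

/-- Differentiating the transported identities along `y l`. -/
lemma sum_deriv_mul_fderiv_single [DecidableEq ι] {h : (ι → ℝ) → (ι → ℝ)}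
    (hdiff : Differentiable ℝ h) {e e' : ι → ℝ → ℝ} (he : ∀ i, Differentiable ℝ (e i))
    (he' : ∀ i, Differentiable ℝ (e' i))
    (heq : ∀ y, ∑ i, e i (h y i) = ∑ i, e' i (y i)) (y : ι → ℝ) (l : ι) :
    ∑ i, deriv (e i) (h y i) * fderiv ℝ h y (Pi.single l 1) i = deriv (e' l) (y l) := by
  have h1 : HasFDerivAt (fun y => ∑ i, e i (h y i)) (∑ i, deriv (e i) (h y i) •
      ((ContinuousLinearMap.proj i : (ι → ℝ) →L[ℝ] ℝ).comp (fderiv ℝ h y))) y := by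
    refine HasFDerivAt.fun_sum fun i _ => ?_
    exact (he i (h y i)).hasDerivAt.comp_hasFDerivAt y
      ((ContinuousLinearMap.proj i : (ι → ℝ) →L[ℝ] ℝ).hasFDerivAt.comp y (hdiff y).hasFDerivAt)
  have h2 : HasFDerivAt (fun y => ∑ i, e' i (y i)) (∑ i, deriv (e' i) (y i) •
      (ContinuousLinearMap.proj i : (ι → ℝ) →L[ℝ] ℝ)) y := by
    refine HasFDerivAt.fun_sum fun i _ => ?_
    exact (he' i (y i)).hasDerivAt.comp_hasFDerivAt y
      (ContinuousLinearMap.proj i : (ι → ℝ) →L[ℝ] ℝ).hasFDerivAt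
  have h3 : (fun y => ∑ i, e i (h y i)) = fun y => ∑ i, e' i (y i) := funext heq
  rw [h3] at h1
  have := congrArg (fun A : (ι → ℝ) →L[ℝ] ℝ => A (Pi.single l 1)) (h1.unique h2)
  simpa [Pi.single_apply] using this

open Asymptotics Filter Topology in
/-- The two consequences of the second-order identities, with `w` a direction in which the `l`-th
coordinate is constant: the mixed second derivatives of `h` vanish, and so do the products of first
derivatives of one component in different coordinates. -/
lemma TransportsSeparableAt.second_order [DecidableEq ι] {h : (ι → ℝ) → (ι → ℝ)} {y₀ : ι → ℝ}
    (H : TransportsSeparableAt h y₀) (hdiff : Differentiable ℝ h) {l : ι} {w : ι → ℝ}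
    (hw : w l = 0) (i : ι) :
    HasDerivAt (fun t : ℝ => fderiv ℝ h (y₀ + t • w) (Pi.single l 1) i) 0 0 ∧
      fderiv ℝ h y₀ w i * fderiv ℝ h y₀ (Pi.single l 1) i = 0 := by
  obtain ⟨e, e', he, he2, he', heq, h1, h2⟩ := H
  set v : ℝ → ι → ℝ := fun t => fderiv ℝ h (y₀ + t • w) (Pi.single l 1) with hv
  set m : ι ⊕ ι → ι → ℝ → ℝ := fun a i t => deriv (e a i) (h (y₀ + t • w) i) with hm
  have hmv : ∀ a t, ∑ i, m a i t * v t i = ∑ i, m a i 0 * v 0 i := by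
    intro a t
    simp only [hm, hv]
    rw [sum_deriv_mul_fderiv_single hdiff (he a) (he' a) (heq a),
      sum_deriv_mul_fderiv_single hdiff (he a) (he' a) (heq a)]
    simp [hw]
  have hm0 : ∀ a i, m a i 0 = if a = Sum.inl i then 1 else 0 := by
    intro a i
    simp [hm, h1]
  have hm' : ∀ a i, HasDerivAt (m a i)
      ((if a = Sum.inr i then 1 else 0) * fderiv ℝ h y₀ w i) 0 := by
    intro a i
    have hline : HasDerivAt (fun t : ℝ => y₀ + t • w) w 0 := by
      simpa using ((hasDerivAt_id (0 : ℝ)).smul_const w).const_add y₀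
    have hh : HasFDerivAt h (fderiv ℝ h y₀) (y₀ + (0 : ℝ) • w) := by
      simpa using (hdiff y₀).hasFDerivAt
    have hhi : HasDerivAt (fun t : ℝ => h (y₀ + t • w) i) (fderiv ℝ h y₀ w i) 0 :=
      hasDerivAt_pi.1 (hh.comp_hasDerivAt (0 : ℝ) hline) i
    have h2' : HasDerivAt (deriv (e a i)) (if a = Sum.inr i then 1 else 0)
        (h (y₀ + (0 : ℝ) • w) i) := by
      rw [← h2 a i]
      simpa using (he2 a i (h y₀ i)).hasDerivAt
    exact h2'.comp (0 : ℝ) hhi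
  have hsub : ∀ a t, v t a - v 0 a
      = ∑ i, -(m (Sum.inl a) i t - m (Sum.inl a) i 0) * v t i := by
    intro a t
    have e1 := hmv (Sum.inl a) t
    have e2 : ∀ s, ∑ i, m (Sum.inl a) i 0 * v s i = v s a := by
      intro s
      simp [hm0]
    simp only [sub_mul, neg_sub, Finset.sum_sub_distrib]
    rw [e1, e2, e2]
  -- The vector `v t - v 0` is `o(v t)`, so `v` is bounded near `0`.
  have hvO : v =O[𝓝 0] fun _ => (1 : ℝ) := by
    have ho : (fun t => v t - v 0) =o[𝓝 0] v := by
      rw [isLittleO_pi]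
      intro a
      simp only [Pi.sub_apply, hsub]
      refine IsLittleO.fun_sum fun i _ => ?_
      have h3 : (fun t => -(m (Sum.inl a) i t - m (Sum.inl a) i 0)) =o[𝓝 0]
          fun _ => (1 : ℝ) := by
        rw [isLittleO_one_iff]
        have := ((hm' (Sum.inl a) i).continuousAt.tendsto.sub_const (m (Sum.inl a) i 0)).neg
        simpa using this
      have h4 : (fun t => v t i) =O[𝓝 0] fun t => ‖v t‖ :=
        IsBigO.of_bound 1 (Eventually.of_forall fun t => by
          simpa using norm_le_pi_norm (v t) i)
      simpa using (h3.mul_isBigO h4).norm_right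
    have := ho.right_isBigO_sub
    simp only [sub_sub_cancel] at this
    exact this.trans (isBigO_const_const _ one_ne_zero _)
  -- The entries of `m (inl a)` are `m (inl a) i 0 + o(t)` because the second derivatives vanish.
  have hv' : ∀ a, HasDerivAt (fun t => v t a) 0 0 := by
    intro a
    rw [hasDerivAt_iff_isLittleO]
    simp only [hsub, smul_zero, sub_zero]
    refine IsLittleO.fun_sum fun i _ => ?_
    have h3 := (hasDerivAt_iff_isLittleO.1 (hm' (Sum.inl a) i))
    simp only [reduceCtorEq, if_false, zero_mul, smul_zero, sub_zero] at h3
    have h4 : (fun t => v t i) =O[𝓝 0] fun _ => (1 : ℝ) := isBigO_pi.1 hvO i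
    simpa using h3.neg_left.mul_isBigO h4
  refine ⟨hv' i, ?_⟩
  have hconst : HasDerivAt (fun t => ∑ j, m (Sum.inr i) j t * v t j) 0 0 := by
    simp_rw [hmv (Sum.inr i)]
    exact hasDerivAt_const _ _
  have hprod := HasDerivAt.fun_sum (u := Finset.univ)
    fun j (_ : j ∈ Finset.univ) => (hm' (Sum.inr i) j).mul (hv' j)
  have := hprod.unique hconst
  simpa [hv] using this

/-- A function that is constant in all directions in which the `l`-th coordinate is constant
depends on the `l`-th coordinate only. -/
lemma eq_of_fderiv_eq_zero_of_apply_eq {F : (ι → ℝ) → ℝ} {l : ι} (hF : Differentiable ℝ F)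
    (h0 : ∀ y w, w l = 0 → fderiv ℝ F y w = 0) {y y' : ι → ℝ} (hy : y l = y' l) : F y = F y' := by
  have hd : ∀ t : ℝ, HasDerivAt (fun t : ℝ => F (y + t • (y' - y))) 0 t := by
    intro t
    have hline : HasDerivAt (fun t : ℝ => y + t • (y' - y)) (y' - y) t := by
      simpa using ((hasDerivAt_id t).smul_const (y' - y)).const_add y
    have := (hF _).hasFDerivAt.comp_hasDerivAt t hline
    rwa [h0 _ _ (by simp [hy])] at this
  have := is_const_of_deriv_eq_zero (fun t => (hd t).differentiableAt) (fun t => (hd t).deriv) 0 1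
  simpa using this

/-- Each component of a surjective map that transports separable functions depends on a single
coordinate. -/
lemma exists_coordinate_of_transportsSeparableAt [DecidableEq ι] {h : (ι → ℝ) → (ι → ℝ)}
    (hc : Continuous h) (hsurj : Function.Surjective h) (H : ∀ y, TransportsSeparableAt h y)
    (i : ι) : ∃ l : ι, ∀ y y' : ι → ℝ, y l = y' l → h y i = h y' i := by
  have hdiff : Differentiable ℝ h := fun y => (H y).differentiableAt hc.continuousAt
  have hdi : Differentiable ℝ fun y => h y i := differentiable_pi.1 hdiff i
  have hfi : ∀ y w, fderiv ℝ (fun y => h y i) y w = fderiv ℝ h y w i := by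
    intro y w
    have := hasFDerivAt_pi'.1 (hdiff y).hasFDerivAt i
    rw [this.fderiv]
    rfl
  have hbasis : ∀ y w, (∀ k, w k ≠ 0 → fderiv ℝ h y (Pi.single k 1) i = 0) →
      fderiv ℝ h y w i = 0 := by
    intro y w hw
    have hw' : w = ∑ k, w k • (Pi.single k 1 : ι → ℝ) := by
      ext j
      simp [Finset.sum_apply, Pi.single_apply]
    rw [hw', map_sum, Finset.sum_apply]
    refine Finset.sum_eq_zero fun k _ => ?_
    by_cases hk : w k = 0
    · simp [hk]
    · simp [hw k hk]
  -- The partial derivative along a coordinate depends on this coordinate only.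
  have hone : ∀ (l : ι) (y y' : ι → ℝ), y l = y' l →
      fderiv ℝ h y (Pi.single l 1) i = fderiv ℝ h y' (Pi.single l 1) i := by
    intro l y y' hy
    have hd : ∀ t : ℝ,
        HasDerivAt (fun t : ℝ => fderiv ℝ h (y + t • (y' - y)) (Pi.single l 1) i) 0 t := by
      intro t
      have h0 := ((H (y + t • (y' - y))).second_order hdiff (l := l) (w := y' - y)
        (by simp [hy]) i).1
      have h1 : HasDerivAt (fun s : ℝ => fderiv ℝ h (y + t • (y' - y) + s • (y' - y))
          (Pi.single l 1) i) 0 (t - t) := by simpa using h0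
      have h2 := h1.comp_sub_const t t
      refine h2.congr_of_eventuallyEq (Filter.Eventually.of_forall fun s => ?_)
      have : y + t • (y' - y) + (s - t) • (y' - y) = y + s • (y' - y) := by
        rw [sub_smul]; abel
      simp only [this]
    have := is_const_of_deriv_eq_zero (fun t => (hd t).differentiableAt)
      (fun t => (hd t).deriv) 0 1
    simpa using this
  -- If all partial derivatives vanished identically, the component would be constant, against
  -- surjectivity.
  obtain ⟨y₁, l, hl⟩ : ∃ y₁ l, fderiv ℝ h y₁ (Pi.single l 1) i ≠ 0 := by
    by_contra! hcon
    have hz : ∀ y, fderiv ℝ (fun y => h y i) y = 0 := by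
      intro y
      ext w
      simpa [hfi] using hbasis y w fun k _ => hcon y k
    obtain ⟨y, hy⟩ := hsurj 0
    obtain ⟨y', hy'⟩ := hsurj 1
    have := is_const_of_fderiv_eq_zero hdi hz y y'
    simp [hy, hy'] at this
  refine ⟨l, fun y y' => eq_of_fderiv_eq_zero_of_apply_eq hdi fun y w hw => ?_⟩
  rw [hfi]
  -- The derivative along `l` is nonzero on a hyperplane that meets every line in a direction
  -- `k ≠ l`, so the derivative along `k` vanishes there, and hence everywhere.
  have hk : ∀ k, k ≠ l → fderiv ℝ h y (Pi.single k 1) i = 0 := by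
    intro k hkl
    have h1 : fderiv ℝ h (Function.update y l (y₁ l)) (Pi.single l 1) i ≠ 0 := by
      rwa [hone l _ y₁ (by simp)]
    have h2 := ((H (Function.update y l (y₁ l))).second_order hdiff (l := l)
      (w := Pi.single k 1) (by simp [hkl.symm]) i).2
    rw [hone k y (Function.update y l (y₁ l)) (by simp [hkl])]
    exact (mul_eq_zero.1 h2).resolve_right h1
  exact hbasis y w fun k hwk => hk k fun hkl => hwk (hkl ▸ hw)

/-- A homeomorphism each of whose components depends on a single coordinate is a permutation
followed by homeomorphisms of the components. -/
lemma exists_perm_homeomorph_of_coordinate [DecidableEq ι] (h : (ι → ℝ) ≃ₜ (ι → ℝ))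
    (H : ∀ i, ∃ l : ι, ∀ y y' : ι → ℝ, y l = y' l → h y i = h y' i) :
    ∃ (π : Equiv.Perm ι) (T : ι → (ℝ ≃ₜ ℝ)), ∀ y, h y = fun i => T i (y (π i)) := by
  choose σ hσ using H
  have hsurj : Function.Surjective σ := by
    intro l
    by_contra! hl
    have : h 0 = h (Pi.single l 1) := by
      funext i
      exact hσ i _ _ (by simp [hl i])
    have := congrFun (h.injective this) l
    simp at this
  have hbij : Function.Bijective σ := ⟨Finite.injective_iff_surjective.2 hsurj, hsurj⟩
  have hright : ∀ i r, h (fun _ => h.symm (fun _ => r) (σ i)) i = r := by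
    intro i r
    have := hσ i (fun _ => h.symm (fun _ => r) (σ i)) (h.symm fun _ => r) rfl
    simpa using this
  have hinj : ∀ i s s', h (fun _ => s) i = h (fun _ => s') i → s = s' := by
    intro i s s' hs
    have : h (fun j => if j = σ i then s else 0) = h (fun j => if j = σ i then s' else 0) := by
      funext j
      by_cases hj : j = i
      · subst hj
        rw [hσ j _ (fun _ => s) (by simp), hs]
        exact hσ j _ _ (by simp)
      · have : σ j ≠ σ i := fun hh => hj (hbij.1 hh)
        exact hσ j _ _ (by simp [this])
    simpa using congrFun (h.injective this) (σ i)
  refine ⟨Equiv.ofBijective σ hbij, fun i =>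
    { toFun := fun s => h (fun _ => s) i
      invFun := fun r => h.symm (fun _ => r) (σ i)
      left_inv := fun s => hinj i _ _ (hright i _)
      right_inv := hright i
      continuous_toFun := by fun_prop
      continuous_invFun := by fun_prop }, fun y => ?_⟩
  funext i
  exact hσ i _ _ rfl

end Separable

/-! ### Products of measures with positive densities -/

section Density

/-- The measure with log-density `φ` with respect to Lebesgue measure. It is not normalized: that it
is a probability measure is a hypothesis where it matters. -/
noncomputable def expDensity (φ : ℝ → ℝ) : Measure ℝ :=
  volume.withDensity (fun x => ENNReal.ofReal (Real.exp (φ x)))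

lemma measurable_ofReal_exp {α : Type*} [MeasurableSpace α] {φ : α → ℝ} (hφ : Measurable φ) :
    Measurable fun x => ENNReal.ofReal (Real.exp (φ x)) := by
  fun_prop

instance (φ : ℝ → ℝ) : SigmaFinite (expDensity φ) := by
  unfold expDensity
  infer_instance

lemma isOpenPosMeasure_expDensity {φ : ℝ → ℝ} (hφ : Measurable φ) :
    (expDensity φ).IsOpenPosMeasure := by
  refine (withDensity_absolutelyContinuous' (μ := volume)
    (measurable_ofReal_exp hφ).aemeasurable ?_).isOpenPosMeasure
  exact Filter.Eventually.of_forall fun x => by simp [Real.exp_pos]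

lemma expDensity_eq_withDensity {φ ψ : ℝ → ℝ} (hφ : Measurable φ) (hψ : Measurable ψ) :
    expDensity φ =
      (expDensity ψ).withDensity (fun x => ENNReal.ofReal (Real.exp (φ x - ψ x))) := by
  unfold expDensity
  have hsub : Measurable fun x => φ x - ψ x := hφ.sub hψ
  rw [← withDensity_mul _ (measurable_ofReal_exp hψ) (measurable_ofReal_exp hsub)]
  congr 1
  funext x
  simp only [Pi.mul_apply]
  rw [← ENNReal.ofReal_mul (Real.exp_pos _).le, ← Real.exp_add]
  congr 2
  ring

lemma pi_withDensity {ι : Type*} [Fintype ι] {α : ι → Type*} [∀ i, MeasurableSpace (α i)]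
    (μ : ∀ i, Measure (α i)) [∀ i, IsProbabilityMeasure (μ i)]
    {r : ∀ i, α i → ENNReal} (hr : ∀ i, Measurable (r i))
    [∀ i, SigmaFinite ((μ i).withDensity (r i))] :
    Measure.pi (fun i => (μ i).withDensity (r i)) =
      (Measure.pi μ).withDensity (fun z => ∏ i, r i (z i)) := by
  symm
  refine (Measure.pi_eq fun s hs => ?_).symm
  have hm : MeasurableSet (Set.univ.pi s) := MeasurableSet.univ_pi hs
  rw [withDensity_apply _ hm, ← lintegral_indicator hm]
  have h1 : ∀ z : ∀ i, α i, (Set.univ.pi s).indicator (fun z => ∏ i, r i (z i)) z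
      = ∏ i, (s i).indicator (r i) (z i) := by
    intro z
    by_cases hz : z ∈ Set.univ.pi s
    · rw [Set.indicator_of_mem hz]
      exact Finset.prod_congr rfl fun i _ => (Set.indicator_of_mem (hz i trivial) _).symm
    · rw [Set.indicator_of_notMem hz]
      obtain ⟨i, hi⟩ : ∃ i, z i ∉ s i := by simpa [Set.mem_pi] using hz
      exact (Finset.prod_eq_zero (Finset.mem_univ i) (Set.indicator_of_notMem hi _)).symm
  have hX : iIndepFun (fun i (z : ∀ i, α i) => (s i).indicator (r i) (z i)) (Measure.pi μ) :=
    iIndepFun_pi (X := fun i => (s i).indicator (r i)) fun i =>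
      ((hr i).indicator (hs i)).aemeasurable
  simp_rw [h1]
  rw [lintegral_prod_eq_prod_lintegral_of_indepFun Finset.univ _ hX
    fun i => ((hr i).indicator (hs i)).comp (measurable_pi_apply i)]
  refine Finset.prod_congr rfl fun i _ => ?_
  rw [withDensity_apply _ (hs i), ← lintegral_indicator (hs i),
    ← (measurePreserving_eval μ i).lintegral_comp ((hr i).indicator (hs i))]

lemma map_withDensity_homeomorph {X Y : Type*} [TopologicalSpace X] [TopologicalSpace Y]
    [MeasurableSpace X] [MeasurableSpace Y] [BorelSpace X] [BorelSpace Y] (h : X ≃ₜ Y)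
    (μ : Measure X) {r : X → ENNReal} (hr : Measurable r) :
    (μ.withDensity r).map h = (μ.map h).withDensity (fun y => r (h.symm y)) := by
  ext s hs
  have hr' : Measurable fun y => r (h.symm y) := hr.comp h.symm.measurable
  rw [Measure.map_apply h.measurable hs, withDensity_apply _ (h.measurable hs),
    withDensity_apply _ hs, setLIntegral_map hs hr' h.measurable]
  simp

lemma pi_expDensity_eq_withDensity {ι : Type*} [Fintype ι] {a b : ι → ℝ → ℝ}
    (ha : ∀ i, Continuous (a i)) (hb : ∀ i, Continuous (b i))
    (hpb : ∀ i, IsProbabilityMeasure (expDensity (b i))) :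
    Measure.pi (fun i => expDensity (a i)) = (Measure.pi (fun i => expDensity (b i))).withDensity
      (fun z => ENNReal.ofReal (Real.exp (∑ i, (a i (z i) - b i (z i))))) := by
  have h1 := fun i => expDensity_eq_withDensity (ha i).measurable (hb i).measurable
  have : ∀ i, SigmaFinite ((expDensity (b i)).withDensity
      (fun x => ENNReal.ofReal (Real.exp (a i x - b i x)))) := fun i => by
    rw [← h1]; infer_instance
  conv_lhs => rw [show (fun i => expDensity (a i)) = _ from funext h1]
  have hsub : ∀ i, Measurable fun x => a i x - b i x := fun i =>
    (ha i).measurable.sub (hb i).measurable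
  rw [pi_withDensity _ fun i => measurable_ofReal_exp (hsub i)]
  congr 1
  funext z
  rw [Real.exp_sum, ENNReal.ofReal_prod_of_nonneg fun i _ => (Real.exp_pos _).le]

/-- If a homeomorphism carries two product laws to two product laws, it carries the log-ratio of
the first two to the log-ratio of the others: the Jacobian, which need not exist, cancels. -/
lemma sum_sub_eq_of_map_pi_expDensity {ι : Type*} [Fintype ι] (h : (ι → ℝ) ≃ₜ (ι → ℝ))
    {a b a' b' : ι → ℝ → ℝ} (ha : ∀ i, Continuous (a i)) (hb : ∀ i, Continuous (b i))
    (ha' : ∀ i, Continuous (a' i)) (hb' : ∀ i, Continuous (b' i))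
    (hpb : ∀ i, IsProbabilityMeasure (expDensity (b i)))
    (hpb' : ∀ i, IsProbabilityMeasure (expDensity (b' i)))
    (hmapa : (Measure.pi fun i => expDensity (a' i)).map h = Measure.pi fun i => expDensity (a i))
    (hmapb : (Measure.pi fun i => expDensity (b' i)).map h = Measure.pi fun i => expDensity (b i))
    (y : ι → ℝ) :
    ∑ i, (a i (h y i) - b i (h y i)) = ∑ i, (a' i (y i) - b' i (y i)) := by
  have hR : Continuous fun z : ι → ℝ =>
      ENNReal.ofReal (Real.exp (∑ i, (a i (z i) - b i (z i)))) := by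
    refine ENNReal.continuous_ofReal.comp (Real.continuous_exp.comp ?_)
    exact continuous_finsetSum _ fun i _ => ((ha i).comp (continuous_apply i)).sub
      ((hb i).comp (continuous_apply i))
  have hR' : Continuous fun z : ι → ℝ =>
      ENNReal.ofReal (Real.exp (∑ i, (a' i (z i) - b' i (z i)))) := by
    refine ENNReal.continuous_ofReal.comp (Real.continuous_exp.comp ?_)
    exact continuous_finsetSum _ fun i _ => ((ha' i).comp (continuous_apply i)).sub
      ((hb' i).comp (continuous_apply i))
  rw [pi_expDensity_eq_withDensity ha hb hpb, pi_expDensity_eq_withDensity ha' hb' hpb',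
    map_withDensity_homeomorph h _ hR'.measurable, hmapb] at hmapa
  have := fun i => isOpenPosMeasure_expDensity (hb i).measurable
  have hae := (withDensity_eq_iff_of_sigmaFinite
    (hR'.comp h.symm.continuous).measurable.aemeasurable hR.measurable.aemeasurable).1 hmapa
  have heq := congrFun ((Continuous.ae_eq_iff_eq _ (hR'.comp h.symm.continuous) hR).1 hae) (h y)
  simp only [Function.comp_apply, Homeomorph.symm_apply_apply] at heq
  rw [ENNReal.ofReal_eq_ofReal_iff (Real.exp_pos _).le (Real.exp_pos _).le] at heq
  exact (Real.exp_injective heq).symm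

end Density

/-! ### Kernels with full support and continuity -/

section Kernels

lemma ProbabilityTheory.IndepFun.prodMk_left_of_prodMk_right {Ω α β γ : Type*} [MeasurableSpace Ω]
    [MeasurableSpace α] [MeasurableSpace β] [MeasurableSpace γ] {μ : Measure Ω}
    [IsProbabilityMeasure μ] {X : Ω → α} {Y : Ω → β} {Z : Ω → γ} (hX : Measurable X)
    (hY : Measurable Y) (hZ : Measurable Z) (h : IndepFun X (fun ω => (Y ω, Z ω)) μ)
    (hYZ : IndepFun Y Z μ) : IndepFun (fun ω => (X ω, Y ω)) Z μ := by
  have hXY : IndepFun X Y μ := h.comp measurable_id measurable_fst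
  have := Measure.isProbabilityMeasure_map (μ := μ) hX.aemeasurable
  have := Measure.isProbabilityMeasure_map (μ := μ) hY.aemeasurable
  have := Measure.isProbabilityMeasure_map (μ := μ) hZ.aemeasurable
  rw [indepFun_iff_map_prod_eq_prod_map_map (by fun_prop) (by fun_prop),
    hXY.map_prod_eq_prod_map_map (by fun_prop) (by fun_prop)]
  have h1 := h.map_prod_eq_prod_map_map (by fun_prop) (by fun_prop)
  rw [hYZ.map_prod_eq_prod_map_map (by fun_prop) (by fun_prop)] at h1
  have h2 := congrArg (Measure.map MeasurableEquiv.prodAssoc.symm) h1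
  rw [Measure.map_map (by fun_prop) (by fun_prop)] at h2
  rw [← (measurePreserving_prodAssoc (μ.map X) (μ.map Y) (μ.map Z)).symm.map_eq, ← h2]
  rfl

/-- The law of `S x e` when `e` has law `N`, as a kernel in `x`. -/
noncomputable def noiseKernel {X E Y : Type*} [MeasurableSpace X] [MeasurableSpace E]
    [MeasurableSpace Y] (N : Measure E) (S : X → E → Y) : Kernel X Y :=
  (Kernel.id ×ₖ Kernel.const X N).map (Function.uncurry S)

variable {X E Y : Type*} [MeasurableSpace X] [MeasurableSpace E] [MeasurableSpace Y]

lemma noiseKernel_apply {N : Measure E} [SFinite N] {S : X → E → Y}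
    (hS : Measurable (Function.uncurry S)) (x : X) : noiseKernel N S x = N.map (S x) := by
  rw [noiseKernel, Kernel.map_apply _ hS, Kernel.prod_apply, Kernel.id_apply, Kernel.const_apply,
    Measure.dirac_prod, Measure.map_map hS (by fun_prop)]
  rfl

lemma isMarkovKernel_noiseKernel {N : Measure E} [IsProbabilityMeasure N] {S : X → E → Y}
    (hS : Measurable (Function.uncurry S)) : IsMarkovKernel (noiseKernel N S) :=
  Kernel.IsMarkovKernel.map _ hS

lemma map_prodMk_eq_compProd_noiseKernel {Ω : Type*} [MeasurableSpace Ω] {P : Measure Ω}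
    [IsProbabilityMeasure P] {H : Ω → X} {e : Ω → E} {S : X → E → Y} (hH : Measurable H)
    (he : Measurable e) (hS : Measurable (Function.uncurry S)) (hind : IndepFun H e P) :
    P.map (fun ω => (H ω, S (H ω) (e ω))) = P.map H ⊗ₘ noiseKernel (P.map e) S := by
  have := Measure.isProbabilityMeasure_map (μ := P) hH.aemeasurable
  have := Measure.isProbabilityMeasure_map (μ := P) he.aemeasurable
  have := isMarkovKernel_noiseKernel (N := P.map e) hS
  have hm : Measurable fun p : X × E => (p.1, S p.1 p.2) := measurable_fst.prodMk hS
  have h1 : P.map (fun ω => (H ω, S (H ω) (e ω)))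
      = ((P.map H).prod (P.map e)).map (fun p => (p.1, S p.1 p.2)) := by
    rw [← hind.map_prod_eq_prod_map_map hH.aemeasurable he.aemeasurable,
      Measure.map_map hm (hH.prodMk he)]
    rfl
  rw [h1]
  ext s hs
  rw [Measure.map_apply hm hs, Measure.prod_apply (hm hs), Measure.compProd_apply hs]
  refine lintegral_congr fun x => ?_
  have hSx : Measurable (S x) := hS.comp measurable_prodMk_left
  rw [noiseKernel_apply hS, Measure.map_apply hSx (measurable_prodMk_left hs)]
  rfl

/-- Transport of a disintegration along measurable equivalences. -/
lemma map_compProd_prodMap {X' Y' : Type*} [MeasurableSpace X'] [MeasurableSpace Y']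
    (μ : Measure X) [SFinite μ] (κ : Kernel X Y) [IsSFiniteKernel κ] (f : X ≃ᵐ X') (g : Y → Y')
    (hg : Measurable g) :
    (μ ⊗ₘ κ).map (fun p => (f p.1, g p.2)) =
      (μ.map f) ⊗ₘ ((κ.map g).comap f.symm f.symm.measurable) := by
  have hm : Measurable fun p : X × Y => (f p.1, g p.2) := by fun_prop
  ext s hs
  rw [Measure.map_apply hm hs, Measure.compProd_apply (hm hs), Measure.compProd_apply hs,
    lintegral_map_equiv]
  refine lintegral_congr fun x => ?_
  rw [Kernel.comap_apply, Kernel.map_apply _ hg, Measure.map_apply hg (measurable_prodMk_left hs)]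
  simp only [MeasurableEquiv.symm_apply_apply]
  rfl

lemma continuous_integral_comp {X E Y : Type*} [TopologicalSpace X] [TopologicalSpace E]
    [TopologicalSpace Y] [MeasurableSpace E] [FirstCountableTopology X] [OpensMeasurableSpace E]
    [SecondCountableTopologyEither E ℝ] (N : Measure E) [IsProbabilityMeasure N]
    {S : X → E → Y} (hS : Continuous (Function.uncurry S))
    (ψ : BoundedContinuousFunction Y ℝ) : Continuous fun x => ∫ e, ψ (S x e) ∂N := by
  have hSx : ∀ x, Continuous (S x) := fun x => hS.comp (by fun_prop : Continuous fun e => (x, e))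
  have hSe : ∀ e, Continuous fun x => S x e := fun e =>
    hS.comp (by fun_prop : Continuous fun x => (x, e))
  refine continuous_of_dominated (bound := fun _ => ‖ψ‖)
    (fun x => (ψ.continuous.comp (hSx x)).aestronglyMeasurable)
    (fun x => Filter.Eventually.of_forall fun e => ψ.norm_coe_le_norm _)
    (integrable_const _) (Filter.Eventually.of_forall fun e => ψ.continuous.comp (hSe e))

/-- Laws that depend continuously on a parameter and agree almost everywhere for a measure of full
support agree everywhere. -/
lemma map_eq_map_of_ae_eq {E' : Type*} [MeasurableSpace E'] [TopologicalSpace E']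
    [TopologicalSpace X] [TopologicalSpace E] [TopologicalSpace Y] [BorelSpace Y]
    [HasOuterApproxClosed Y] [FirstCountableTopology X] [OpensMeasurableSpace X]
    [OpensMeasurableSpace E]
    [OpensMeasurableSpace E'] [SecondCountableTopologyEither E ℝ]
    [SecondCountableTopologyEither E' ℝ]
    (N : Measure E) [IsProbabilityMeasure N] (N' : Measure E') [IsProbabilityMeasure N']
    {S : X → E → Y} {S' : X → E' → Y} (hS : Continuous (Function.uncurry S))
    (hS' : Continuous (Function.uncurry S')) (μ : Measure X) [μ.IsOpenPosMeasure]
    (h : ∀ᵐ x ∂μ, N.map (S x) = N'.map (S' x)) (x : X) : N.map (S x) = N'.map (S' x) := by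
  have hSx : ∀ x, Measurable (S x) := fun x =>
    (hS.comp (by fun_prop : Continuous fun e => (x, e))).measurable
  have hSx' : ∀ x, Measurable (S' x) := fun x =>
    (hS'.comp (by fun_prop : Continuous fun e => (x, e))).measurable
  have := Measure.isProbabilityMeasure_map (μ := N) (hSx x).aemeasurable
  have := Measure.isProbabilityMeasure_map (μ := N') (hSx' x).aemeasurable
  refine ext_of_forall_integral_eq_of_IsFiniteMeasure fun ψ => ?_
  have key : (fun x => ∫ e, ψ (S x e) ∂N) = fun x => ∫ e, ψ (S' x e) ∂N' := by
    refine Continuous.ext_on (Measure.dense_of_ae h) (continuous_integral_comp N hS ψ)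
      (continuous_integral_comp N' hS' ψ) fun x hx => ?_
    have hx' : N.map (S x) = N'.map (S' x) := hx
    have := congrArg (fun ν => ∫ y, ψ y ∂ν) hx'
    rwa [integral_map (hSx x).aemeasurable ψ.continuous.measurable.aestronglyMeasurable,
      integral_map (hSx' x).aemeasurable ψ.continuous.measurable.aestronglyMeasurable] at this
  rw [integral_map (hSx x).aemeasurable ψ.continuous.measurable.aestronglyMeasurable,
    integral_map (hSx' x).aemeasurable ψ.continuous.measurable.aestronglyMeasurable]
  exact congrFun key x

end Kernels

/-! ### The Markov structure of a nonparametric process -/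

namespace NonparametricProcess

variable {n m L : ℕ} {U Ω Ω' : Type*} [MeasurableSpace Ω] [MeasurableSpace Ω']

/-- The history before time `t + L`: the values at the times `t + L - 1, …, t`, in this order. -/
def hist (M : NonparametricProcess n m L U Ω) (t : ℕ) (ω : Ω) : LatentHistory n L :=
  fun τ j => M.z (t + L - (τ + 1)) ω j

/-- The new latent vector, from the history and the noise. -/
def step (M : NonparametricProcess n m L U Ω) (H : LatentHistory n L) (e : Fin n → ℝ) :
    Fin n → ℝ :=
  fun i => M.f i (fun p => H p.1.1 p.1.2, e i)

/-- The joint law of the noise components at one time. -/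
noncomputable def noiseLaw (M : NonparametricProcess n m L U Ω) (u : U) : Measure (Fin n → ℝ) :=
  Measure.pi (M.noise u)

/-- Shifts a history by one time step and puts the new value `y` at lag one. -/
def pushHistory (H : LatentHistory n L) (y : Fin n → ℝ) : LatentHistory n L :=
  fun τ => if (τ : ℕ) = 0 then y else H ⟨τ - 1, by omega⟩

lemma measurable_pushHistory :
    Measurable (Function.uncurry (pushHistory : LatentHistory n L → _ → _)) := by
  refine measurable_pi_iff.2 fun τ => ?_
  by_cases hτ : (τ : ℕ) = 0
  · simpa [Function.uncurry, pushHistory, hτ] using measurable_snd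
  · simp only [Function.uncurry, pushHistory, hτ, if_false]
    fun_prop

variable (M : NonparametricProcess n m L U Ω)

lemma hist_succ (t : ℕ) (ω : Ω) : M.hist (t + 1) ω = pushHistory (M.hist t ω) (M.z (t + L) ω) := by
  funext τ j
  by_cases hτ : (τ : ℕ) = 0
  · have ht : t + 1 + L - (τ + 1) = t + L := by omega
    simp only [hist, pushHistory, hτ, if_true, ← ht]
  · have ht : t + 1 + L - (τ + 1) = t + L - (τ - 1 + 1) := by omega
    simp only [hist, pushHistory, hτ, if_false, ht]

lemma transition_step (u : U) :
    ∀ᵐ ω ∂(M.P u), ∀ t, M.z (t + L) ω = M.step (M.hist t ω) (M.ε t ω) := by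
  filter_upwards [M.transition u] with ω hω t
  funext i
  exact hω t i

lemma measurable_hist (t : ℕ) : Measurable (M.hist t) :=
  measurable_pi_iff.2 fun _ => M.measurable_z _

lemma continuous_f (i : Fin n) : Continuous (M.f i) := (M.f_diff i).1.continuous

lemma continuous_step : Continuous (Function.uncurry M.step) := by
  refine continuous_pi fun i => (M.continuous_f i).comp ?_
  fun_prop

lemma continuous_q (u : U) (i : Fin n) (H : LatentHistory n L) : Continuous (M.q u i H) :=
  (M.q_diff u i H).continuous

lemma isProbabilityMeasure_noise (u : U) (i : Fin n) : IsProbabilityMeasure (M.noise u i) := by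
  have := M.isProb u
  rw [← M.noise_law u 0 i]
  exact Measure.isProbabilityMeasure_map
    ((measurable_pi_apply i).comp (M.measurable_ε 0)).aemeasurable

lemma isProbabilityMeasure_noiseLaw (u : U) : IsProbabilityMeasure (M.noiseLaw u) := by
  have := M.isProbabilityMeasure_noise u
  unfold noiseLaw
  infer_instance

lemma measurable_ε_apply (t : ℕ) (i : Fin n) : Measurable fun ω => M.ε t ω i :=
  (measurable_pi_apply i).comp (M.measurable_ε t)

lemma map_ε (u : U) (t : ℕ) : (M.P u).map (M.ε t) = M.noiseLaw u := by
  have h : iIndepFun (fun (i : Fin n) ω => M.ε t ω i) (M.P u) :=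
    (M.noise_indep u).precomp (g := fun i : Fin n => (t, i)) fun i j hij => (Prod.mk.inj hij).2
  have := h.map_fun_eq_pi_map fun i => (M.measurable_ε_apply t i).aemeasurable
  simp only [M.noise_law] at this
  exact this

lemma isProbabilityMeasure_expDensity (u : U) (i : Fin n) (H : LatentHistory n L) :
    IsProbabilityMeasure (expDensity (M.q u i H)) := by
  have := M.isProbabilityMeasure_noise u i
  rw [expDensity, ← M.density u i H]
  refine Measure.isProbabilityMeasure_map ((M.continuous_f i).comp ?_).measurable.aemeasurable
  fun_prop

lemma map_step (u : U) (H : LatentHistory n L) :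
    (M.noiseLaw u).map (M.step H) = Measure.pi fun i => expDensity (M.q u i H) := by
  have := M.isProbabilityMeasure_noise u
  have hd : ∀ i, (M.noise u i).map (fun e => M.f i (fun p => H p.1.1 p.1.2, e))
      = expDensity (M.q u i H) := fun i => M.density u i H
  have : ∀ i, SigmaFinite ((M.noise u i).map (fun e => M.f i (fun p => H p.1.1 p.1.2, e))) :=
    fun i => by rw [hd i]; infer_instance
  have h := Measure.pi_map_pi (μ := M.noise u)
    (f := fun i e => M.f i (fun p => H p.1.1 p.1.2, e)) fun i =>
      ((M.continuous_f i).comp (by fun_prop)).measurable.aemeasurable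
  simp only [hd] at h
  exact h

/-- The history is independent of the noise that enters from then on, over any finite horizon. -/
lemma indepFun_hist_noise (u : U) (t K : ℕ) :
    IndepFun (M.hist t) (fun ω (k : Fin K) => M.ε (t + k) ω) (M.P u) := by
  have := M.isProb u
  induction t generalizing K with
  | zero =>
    have h := (M.init_indep u).comp
      (φ := fun (z : Fin L → Fin n → ℝ) (τ : Fin L) => z ⟨L - (τ + 1), by omega⟩)
      (ψ := fun (e : ℕ × Fin n → ℝ) (k : Fin K) (i : Fin n) => e (k, i))
      (by fun_prop) (by fun_prop)
    refine h.congr (Filter.Eventually.of_forall fun ω => ?_)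
      (Filter.Eventually.of_forall fun ω => ?_)
    · funext τ j
      simp [hist]
    · funext k i
      simp
  | succ t ih =>
    have hY : Measurable (M.ε t) := M.measurable_ε t
    have hZ : Measurable (fun ω (k : Fin K) => M.ε (t + 1 + k) ω) :=
      measurable_pi_iff.2 fun k => M.measurable_ε _
    have h1 : IndepFun (M.hist t) (fun ω => (M.ε t ω, fun k : Fin K => M.ε (t + 1 + k) ω))
        (M.P u) := by
      have h := (ih (K + 1)).comp (φ := id)
        (ψ := fun (e : Fin (K + 1) → Fin n → ℝ) => (e 0, fun k : Fin K => e k.succ))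
        measurable_id (by fun_prop)
      refine h.congr (Filter.Eventually.of_forall fun ω => rfl)
        (Filter.Eventually.of_forall fun ω => ?_)
      simp [add_assoc, add_comm 1]
    have h2 : IndepFun (M.ε t) (fun ω (k : Fin K) => M.ε (t + 1 + k) ω) (M.P u) := by
      have h := (M.noise_indep u).indepFun_finset ({t} ×ˢ Finset.univ)
        (Finset.Ico (t + 1) (t + 1 + K) ×ˢ Finset.univ)
        (Finset.disjoint_product.2 (Or.inl (by simp))) fun p => M.measurable_ε_apply p.1 p.2
      exact h.comp
        (φ := fun v (i : Fin n) => v ⟨(t, i), by simp⟩)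
        (ψ := fun v (k : Fin K) (i : Fin n) => v ⟨(t + 1 + k, i), by simp⟩)
        (measurable_pi_iff.2 fun i => measurable_pi_apply _)
        (measurable_pi_iff.2 fun k => measurable_pi_iff.2 fun i => measurable_pi_apply _)
    have h3 := (h1.prodMk_left_of_prodMk_right (M.measurable_hist t) hY hZ h2).comp
      (φ := fun p : LatentHistory n L × (Fin n → ℝ) => pushHistory p.1 (M.step p.1 p.2))
      (ψ := id)
      (measurable_pushHistory.comp (measurable_fst.prodMk M.continuous_step.measurable))
      measurable_id
    refine h3.congr ?_ (Filter.Eventually.of_forall fun ω => rfl)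
    filter_upwards [M.transition_step u] with ω hω
    simp [hist_succ, hω t]

/-- The conditional law of the latent vector given the history, as a kernel. -/
noncomputable def condKernel (u : U) : Kernel (LatentHistory n L) (Fin n → ℝ) :=
  noiseKernel (M.noiseLaw u) M.step

lemma isMarkovKernel_condKernel (u : U) : IsMarkovKernel (M.condKernel u) :=
  have := M.isProbabilityMeasure_noiseLaw u
  isMarkovKernel_noiseKernel M.continuous_step.measurable

lemma condKernel_apply (u : U) (H : LatentHistory n L) :
    M.condKernel u H = (M.noiseLaw u).map (M.step H) :=
  have := M.isProbabilityMeasure_noiseLaw u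
  noiseKernel_apply M.continuous_step.measurable H

lemma isOpenPosMeasure_condKernel (u : U) (H : LatentHistory n L) :
    (M.condKernel u H).IsOpenPosMeasure := by
  rw [condKernel_apply, map_step]
  have := fun i => isOpenPosMeasure_expDensity (M.continuous_q u i H).measurable
  infer_instance

/-- The history and the next latent vector are distributed according to the kernel. -/
lemma map_hist_prodMk (u : U) (t : ℕ) :
    (M.P u).map (fun ω => (M.hist t ω, M.z (t + L) ω))
      = (M.P u).map (M.hist t) ⊗ₘ M.condKernel u := by
  have := M.isProb u
  have hind : IndepFun (M.hist t) (M.ε t) (M.P u) :=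
    (M.indepFun_hist_noise u t 1).comp (φ := id)
      (ψ := fun e : Fin 1 → Fin n → ℝ => e 0) measurable_id (measurable_pi_apply 0)
  rw [condKernel, ← M.map_ε u t, ← map_prodMk_eq_compProd_noiseKernel (M.measurable_hist t)
    (M.measurable_ε t) M.continuous_step.measurable hind]
  refine Measure.map_congr ?_
  filter_upwards [M.transition_step u] with ω hω
  rw [hω t]

/-- After `k` transitions the `k` most recent values have full joint support. -/
lemma measure_hist_mem_pos (u : U) (k : ℕ) (O : ℕ → Set (Fin n → ℝ)) (hO : ∀ j, IsOpen (O j))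
    (hne : ∀ j, (O j).Nonempty) :
    0 < (M.P u).map (M.hist k) {H | ∀ τ : Fin L, (τ : ℕ) < k → H τ ∈ O τ} := by
  have := M.isProb u
  induction k generalizing O with
  | zero =>
    have := Measure.isProbabilityMeasure_map (μ := M.P u) (M.measurable_hist 0).aemeasurable
    simp
  | succ k ih =>
    have hB : ∀ (k : ℕ) (O : ℕ → Set (Fin n → ℝ)), (∀ j, IsOpen (O j)) → MeasurableSet
        {H : LatentHistory n L | ∀ τ : Fin L, (τ : ℕ) < k → H τ ∈ O τ} := by
      intro k O hO
      simp only [Set.ofPred_forall]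
      exact MeasurableSet.iInter fun τ => MeasurableSet.iInter fun _ =>
        measurable_pi_apply τ (hO τ).measurableSet
    set B := {H : LatentHistory n L | ∀ τ : Fin L, (τ : ℕ) < k → H τ ∈ O (τ + 1)} with hBdef
    have hBm : MeasurableSet B := hB k (fun j => O (j + 1)) fun j => hO _
    have hpos := ih (fun j => O (j + 1)) (fun j => hO _) fun j => hne _
    have hker : ∀ H, 0 < M.condKernel u H (O 0) := fun H =>
      have := M.isOpenPosMeasure_condKernel u H
      (hO 0).measure_pos _ (hne 0)
    have := M.isMarkovKernel_condKernel u
    have h1 : 0 < ((M.P u).map (M.hist k) ⊗ₘ M.condKernel u) (B ×ˢ O 0) := by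
      rw [Measure.compProd_apply_prod hBm (hO 0).measurableSet,
        setLIntegral_pos_iff (Kernel.measurable_coe _ (hO 0).measurableSet)]
      have : (Function.support fun H => M.condKernel u H (O 0)) = Set.univ :=
        Set.eq_univ_of_forall fun H => (hker H).ne'
      rwa [this, Set.univ_inter]
    rw [← map_hist_prodMk, Measure.map_apply ((M.measurable_hist k).prodMk (M.measurable_z _))
      (hBm.prod (hO 0).measurableSet)] at h1
    rw [Measure.map_apply (M.measurable_hist _) (hB _ O hO)]
    refine h1.trans_le (measure_mono fun ω hω τ hτ => ?_)
    obtain ⟨hω1, hω2⟩ := hω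
    simp only at hω1 hω2
    rw [hist_succ]
    unfold pushHistory
    split_ifs with h0
    · rwa [h0]
    · have h2 := hω1 ⟨τ - 1, by omega⟩ (by simp; omega)
      simp only at h2
      rwa [Nat.sub_add_cancel (by omega)] at h2

/-- The history before time `2 * L` consists of values generated by transitions only, so its law has
full support, whatever the initial values are. -/
lemma isOpenPosMeasure_map_hist (u : U) : ((M.P u).map (M.hist L)).IsOpenPosMeasure := by
  refine ⟨fun O hO ⟨H, hH⟩ => ?_⟩
  obtain ⟨V, hV, hVO⟩ := isOpen_pi_iff'.1 hO H hH
  have h := M.measure_hist_mem_pos u L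
    (fun j => if hj : j < L then V ⟨j, hj⟩ else Set.univ)
    (fun j => by split_ifs with hj; exacts [(hV _).1, isOpen_univ])
    (fun j => by split_ifs with hj; exacts [⟨_, (hV _).2⟩, Set.univ_nonempty])
  refine (h.trans_le (measure_mono fun H' hH' => hVO fun τ _ => ?_)).ne'
  simpa using hH' τ τ.2

/-! ### The change of latent coordinates -/

/-- The change of latent coordinates between two mixing functions with the same range. -/
lemma exists_homeomorph_comp_eq {M : NonparametricProcess n m L U Ω}
    {M' : NonparametricProcess n m L U Ω'} (hrange : Set.range M'.g = Set.range M.g) :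
    ∃ h : (Fin n → ℝ) ≃ₜ (Fin n → ℝ), ∀ y, M.g (h y) = M'.g y := by
  refine ⟨(M'.g_embedding.toHomeomorph.trans (Homeomorph.setCongr hrange)).trans
    M.g_embedding.toHomeomorph.symm, fun y => ?_⟩
  exact congrArg Subtype.val (M.g_embedding.toHomeomorph.apply_symm_apply
    (Homeomorph.setCongr hrange (M'.g_embedding.toHomeomorph y)))

variable {M} {M' : NonparametricProcess n m L U Ω'} {h : (Fin n → ℝ) ≃ₜ (Fin n → ℝ)}

/-- Observational equivalence determines the law of the latent trajectory up to the change of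
coordinates. -/
lemma map_z_eq (hobs : M.ObservationallyEquivalent M') (hh : ∀ y, M.g (h y) = M'.g y) (u : U) :
    (M.P u).map (fun ω t => M.z t ω) = (M'.P u).map (fun ω t => h (M'.z t ω)) := by
  have hemb : MeasurableEmbedding M.g :=
    M.g_embedding.continuous.measurableEmbedding M.g_embedding.injective
  have hG : Measurable fun (x : ℕ → Fin m → ℝ) t => hemb.invFun (x t) :=
    measurable_pi_iff.2 fun t => hemb.measurable_invFun.comp (measurable_pi_apply t)
  have hx : Measurable fun ω t => M.x t ω :=
    measurable_pi_iff.2 fun t => M.g_embedding.continuous.measurable.comp (M.measurable_z t)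
  have hx' : Measurable fun ω t => M'.x t ω :=
    measurable_pi_iff.2 fun t => M'.g_embedding.continuous.measurable.comp (M'.measurable_z t)
  have := congrArg (Measure.map fun (x : ℕ → Fin m → ℝ) t => hemb.invFun (x t)) (hobs u)
  rw [Measure.map_map hG hx, Measure.map_map hG hx'] at this
  simpa [Function.comp_def, x, ← hh, hemb.leftInverse_invFun _] using this

/-- The conditional laws of equivalent processes correspond under the change of coordinates, for
every history. -/
lemma map_pi_expDensity_eq (hobs : M.ObservationallyEquivalent M')
    (hh : ∀ y, M.g (h y) = M'.g y) (u : U) (H' : LatentHistory n L) :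
    (Measure.pi fun i => expDensity (M'.q u i H')).map h
      = Measure.pi fun i => expDensity (M.q u i fun τ => h (H' τ)) := by
  have := M.isProb u
  have := M'.isProb u
  have := M.isMarkovKernel_condKernel u
  have := M'.isMarkovKernel_condKernel u
  have := M.isProbabilityMeasure_noiseLaw u
  have := M'.isProbabilityMeasure_noiseLaw u
  have := M.isOpenPosMeasure_map_hist u
  have := Measure.isProbabilityMeasure_map (μ := M.P u) (M.measurable_hist L).aemeasurable
  let hH : LatentHistory n L ≃ᵐ LatentHistory n L :=
    MeasurableEquiv.piCongrRight fun _ => h.toMeasurableEquiv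
  have hw : Measurable fun (z : ℕ → Fin n → ℝ) =>
      ((fun τ : Fin L => z (L + L - (τ + 1)), z (L + L)) : LatentHistory n L × (Fin n → ℝ)) := by
    fun_prop
  have hz : Measurable fun ω t => M.z t ω := measurable_pi_iff.2 M.measurable_z
  have hz' : Measurable fun ω t => h (M'.z t ω) :=
    measurable_pi_iff.2 fun t => h.measurable.comp (M'.measurable_z t)
  have hjoint : (M.P u).map (M.hist L) ⊗ₘ M.condKernel u =
      ((M'.P u).map (M'.hist L)).map hH ⊗ₘ
        (((M'.condKernel u).map h).comap hH.symm hH.symm.measurable) := by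
    rw [← map_hist_prodMk, ← map_compProd_prodMap _ _ _ _ h.measurable, ← map_hist_prodMk,
      Measure.map_map (by fun_prop) ((M'.measurable_hist L).prodMk (M'.measurable_z _))]
    have := congrArg (Measure.map fun (z : ℕ → Fin n → ℝ) =>
      ((fun τ : Fin L => z (L + L - (τ + 1)), z (L + L)) : LatentHistory n L × (Fin n → ℝ)))
      (map_z_eq hobs hh u)
    rw [Measure.map_map hw hz, Measure.map_map hw hz'] at this
    exact this
  have := Kernel.IsMarkovKernel.map (M'.condKernel u) h.measurable
  have hfst : (M.P u).map (M.hist L) = ((M'.P u).map (M'.hist L)).map hH := by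
    have := congrArg Measure.fst hjoint
    rwa [Measure.fst_compProd, Measure.fst_compProd] at this
  rw [← hfst] at hjoint
  have hae := Kernel.ae_eq_of_compProd_eq hjoint
  have hcont : Continuous (Function.uncurry fun (H : LatentHistory n L) e =>
      h (M'.step (fun τ => h.symm (H τ)) e)) := by
    have hp : Continuous fun p : LatentHistory n L × (Fin n → ℝ) =>
        ((fun τ => h.symm (p.1 τ), p.2) : LatentHistory n L × (Fin n → ℝ)) := by fun_prop
    exact h.continuous.comp (M'.continuous_step.comp hp)
  have hmapstep : ∀ H : LatentHistory n L, ((M'.noiseLaw u).map (M'.step H)).map h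
      = (M'.noiseLaw u).map fun e => h (M'.step H e) := fun H =>
    Measure.map_map h.measurable (M'.continuous_step.comp (Continuous.prodMk_right H)).measurable
  have key := map_eq_map_of_ae_eq (M.noiseLaw u) (M'.noiseLaw u) M.continuous_step hcont
    ((M.P u).map (M.hist L)) (by
      filter_upwards [hae] with H hH'
      rw [condKernel_apply, Kernel.comap_apply, Kernel.map_apply _ h.measurable,
        condKernel_apply, hmapstep] at hH'
      exact hH') (fun τ => h (H' τ))
  simp only [Homeomorph.symm_apply_apply] at key
  rw [← M'.map_step, ← M.map_step, key, hmapstep]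

/-- Sufficient variability makes the change of coordinates transport a normalized family of
separable functions: the differences of the log-densities of consecutive regimes. -/
lemma transportsSeparableAt (hM : M.SufficientVariability)
    (hobs : M.ObservationallyEquivalent M') (hh : ∀ y, M.g (h y) = M'.g y) (y₀ : Fin n → ℝ) :
    TransportsSeparableAt h y₀ := by
  obtain ⟨H, u, hli⟩ := hM (h y₀)
  have hderiv : ∀ (v w : U) i, deriv (fun s => M.q v i H s - M.q w i H s)
      = fun s => deriv (M.q v i H) s - deriv (M.q w i H) s := fun v w i => funext fun s =>
    deriv_fun_sub (M.q_diff v i H s) (M.q_diff w i H s)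
  let H' : LatentHistory n L := fun τ => h.symm (H τ)
  have hHH' : (fun τ => h (H' τ)) = H := by
    funext τ
    simp [H']
  refine transportsSeparableAt_of_linearIndependent (κ := Fin (2 * n))
    (fun k i s => M.q (u k.succ) i H s - M.q (u k.castSucc) i H s)
    (fun k i s => M'.q (u k.succ) i H' s - M'.q (u k.castSucc) i H' s)
    (fun k i => (M.q_diff _ i H).sub (M.q_diff _ i H)) (fun k i => ?_)
    (fun k i => (M'.q_diff _ i H').sub (M'.q_diff _ i H')) (fun k y => ?_) ?_ ?_
  · rw [hderiv]
    exact (M.q_diff_two _ i H).sub (M.q_diff_two _ i H)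
  · refine sum_sub_eq_of_map_pi_expDensity h (fun i => M.continuous_q _ i H)
      (fun i => M.continuous_q _ i H) (fun i => M'.continuous_q _ i H')
      (fun i => M'.continuous_q _ i H') (fun i => M.isProbabilityMeasure_expDensity _ i H)
      (fun i => M'.isProbabilityMeasure_expDensity _ i H') ?_ ?_ y
    · rw [map_pi_expDensity_eq hobs hh, hHH']
    · rw [map_pi_expDensity_eq hobs hh, hHH']
  · convert hli using 1
    funext k a
    rcases a with i | i
    · simp [w, hderiv]
    · simp only [Sum.elim_inr, w, Pi.sub_apply, hderiv]
      exact deriv_fun_sub (M.q_diff_two _ i H _) (M.q_diff_two _ i H _)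
  · simp [two_mul]

end NonparametricProcess

theorem theorem1 {n m L : ℕ} {U Ω Ω' : Type*} [MeasurableSpace Ω] [MeasurableSpace Ω']
    (M : NonparametricProcess n m L U Ω) (hM : M.SufficientVariability)
    (M' : NonparametricProcess n m L U Ω')
    (hrange : Set.range M'.g = Set.range M.g)
    (hobs : M.ObservationallyEquivalent M') :
    ∃ (π : Equiv.Perm (Fin n)) (T : Fin n → (ℝ ≃ₜ ℝ)),
      ∀ y : Fin n → ℝ, M'.g y = M.g (fun i => T i (y (π i))) := by
  obtain ⟨h, hh⟩ := NonparametricProcess.exists_homeomorph_comp_eq hrange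
  obtain ⟨π, T, hT⟩ := exists_perm_homeomorph_of_coordinate h
    (exists_coordinate_of_transportsSeparableAt h.continuous h.surjective
      fun y => NonparametricProcess.transportsSeparableAt hM hobs hh y)
  exact ⟨π, T, fun y => by rw [← hh, hT]⟩
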